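/- A sequence $x_1\ldots x_{2l}$ with $l\ge 1$ is a repetition if $x_i=x_{l+i}$ for all $1\le i\le l$. A vertex coloring $c$ of a graph $G$ is nonrepetitive if there is no path $v_1,\ldots,v_{2l}$ in $G$ such that $c(v_1),\ldots,c(v_{2l})$ is a repetition. The lexicographic product $G[H]$ of graphs $G$ and $H$ has vertex set $V(G)\times V(H)$, and $(v,w)$ is adjacent to $(v',w')$ if either $vv'\in E(G)$, or $v=v'$ and $ww'\in E(H)$; the sets $\{v\}\times V(H)$, $v\in V(G)$, are its layers. A rainbow nonrepetitive coloring of $G[H]$ is a nonrepetitive coloring of $G[H]$ in which the vertices of each layer receive pairwise distinct colors, and $\pi_R(G[H])$ is the least number of colors in such a coloring. Let $P_n$ be the path on $n$ vertices and $E_k$ the edgeless graph on $k$ vertices. **Theorem.** For all integers $n\ge 24$ and $k\ge 2$, $$3k+1\;\le\;\pi_R(P_n[E_k])\;\le\;3k+\lceil k/2\rceil .$$ -/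

import Mathlib

/-- A sequence `x₁ … x₂ₗ` (with `l ≥ 1`) is a repetition if its first half equals its
second half. -/
def IsRepetition {α : Type*} (s : List α) : Prop :=
  ∃ t : List α, t ≠ [] ∧ s = t ++ t

/-- A vertex coloring is nonrepetitive if the sequence of colors along a path is never a
repetition. -/
def IsNonrepetitive {V : Type*} {α : Type*} (G : SimpleGraph V) (c : V → α) : Prop :=
  ∀ (u v : V) (p : G.Walk u v), p.IsPath → ¬ IsRepetition (p.support.map c)

/-- The lexicographic product `G[H]`. -/
def lexProduct {V W : Type*} (G : SimpleGraph V) (H : SimpleGraph W) :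
    SimpleGraph (V × W) where
  Adj x y := G.Adj x.1 y.1 ∨ (x.1 = y.1 ∧ H.Adj x.2 y.2)
  symm := ⟨fun _ _ h => h.imp (fun h => h.symm) (fun h => ⟨h.1.symm, h.2.symm⟩)⟩
  loopless := ⟨fun x h => h.elim (G.loopless.irrefl x.1) (fun h => H.loopless.irrefl x.2 h.2)⟩

/-- A rainbow nonrepetitive coloring of `G[H]`: a nonrepetitive coloring in which the
vertices of every layer `{(v, w) : w ∈ V(H)}` receive pairwise distinct colors. -/
def IsRainbowNonrepetitive {V W : Type*} {α : Type*} (G : SimpleGraph V)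
    (H : SimpleGraph W) (c : V × W → α) : Prop :=
  IsNonrepetitive (lexProduct G H) c ∧ ∀ v : V, Function.Injective fun w : W => c (v, w)

/-- The rainbow Thue chromatic number of `G[H]`: the least number `m` of colors for which
a rainbow nonrepetitive coloring exists (`⊤` if there is no such `m`). -/
noncomputable def rainbowThueNumber {V W : Type*} (G : SimpleGraph V)
    (H : SimpleGraph W) : ℕ∞ :=
  ⨅ m ∈ {m : ℕ | ∃ c : V × W → Fin m, IsRainbowNonrepetitive G H c}, (m : ℕ∞)

/-!
**Lower bound.** With at most `3 * k` colors, three consecutive layers that are pairwise disjoint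
use every color. Of two overlapping triples of layers at least one has this property, as otherwise
four consecutive layers carry a square of period two. It follows that two layers at distance two,
away from the ends of the path, are disjoint or equal (`RepetitionFree.eq_of_mem_of_mem`). So
all layers except the first and the last come from a word over three disjoint color sets. In a
ternary word of length 22, a finite search (`exists_fold_of_ternary`) always finds a path whose halves
read the same: it runs straight and, near its end, turns back on itself. It visits no layer
more than twice, so two colors per layer suffice to turn it into a repetition.

**Upper bound.** The `3 * k + ⌈k / 2⌉` colors are cut into four blocks of size `⌈k / 2⌉` and three
blocks of size `⌊k / 2⌋`, and a layer is made of two blocks. The same layer `M` is placed at each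
multiple of four, and the `n`-th gap is filled with a palindrome `s t s` of a type given
by the `n`-th letter of a word over four letters. As `M` meets no other layer, both halves of a
repetition are at markers simultaneously. For two different types, the layers `s` or
the layers `t` are disjoint, so both halves visit centres of gaps of the same type, and a
repetition becomes a lazy walk on the word of types (`not_walk_gapLayers`). A squarefree word without factors `a b a` has no
such lazy walk (`not_lazy_walk`): two walkers reading the same letters keep either their difference,
which produces a square, or their sum, and in that case they cannot pass each other. Such a word is
`digitSumWord`, the sum of weights of base-13 digits modulo 4. -/

/-! ### Paths as injective sequences of vertices -/

theorem exists_walk_support_eq_map {V : Type*} (G : SimpleGraph V) (f : ℕ → V) (m : ℕ)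
    (hf : ∀ i < m, G.Adj (f i) (f (i + 1))) :
    ∃ p : G.Walk (f 0) (f m), p.support = (List.range (m + 1)).map f := by
  induction m with
  | zero => exact ⟨.nil, by simp⟩
  | succ m ih =>
    obtain ⟨p, hp⟩ := ih fun i hi => hf i (by omega)
    refine ⟨p.concat (hf m (by omega)), ?_⟩
    rw [SimpleGraph.Walk.support_concat, hp, List.range_succ (n := m + 1)]
    simp

/-- Nonrepetitiveness in terms of paths given as functions on `{0, …, 2l - 1}`. -/
theorem isNonrepetitive_iff {V α : Type*} (G : SimpleGraph V) (c : V → α) :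
    IsNonrepetitive G c ↔ ∀ (l : ℕ) (f : ℕ → V), 0 < l →
      (∀ i, i + 1 < 2 * l → G.Adj (f i) (f (i + 1))) →
      (∀ i j, i < j → j < 2 * l → f i ≠ f j) →
      ¬ ∀ i < l, c (f i) = c (f (l + i)) := by
  constructor
  · intro h l f hl hadj hinj hrep
    obtain ⟨p, hp⟩ := exists_walk_support_eq_map G f (2 * l - 1) fun i hi => hadj i (by omega)
    rw [show 2 * l - 1 + 1 = l + l by omega] at hp
    refine h _ _ p ?_ ⟨(List.range l).map (c ∘ f), by simp; omega, ?_⟩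
    · rw [SimpleGraph.Walk.isPath_def, hp]
      refine List.Nodup.map_on ?_ List.nodup_range
      intro i hi j hj hij
      rw [List.mem_range] at hi hj
      by_contra hne
      rcases lt_or_gt_of_ne hne with hlt | hlt
      · exact hinj i j hlt (by omega) hij
      · exact hinj j i hlt (by omega) hij.symm
    · rw [hp, List.range_add, List.map_append, List.map_append]
      simp only [List.map_map]
      congr 1
      refine List.map_congr_left fun i hi => ?_
      simpa using (hrep i (by simpa using hi)).symm
  · rintro h u v p hp ⟨t, ht, hs⟩
    have hlen : p.length + 1 = 2 * t.length := by
      have := congrArg List.length hs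
      simp only [List.length_map, SimpleGraph.Walk.length_support, List.length_append] at this
      omega
    have hcol : ∀ i (hi : i ≤ p.length), c (p.getVert i) = (t ++ t)[i]'(by simp; omega) := by
      intro i hi
      rw [SimpleGraph.Walk.getVert_eq_support_getElem p hi]
      simp only [← hs, List.getElem_map]
    refine h t.length p.getVert (List.length_pos_iff.2 ht)
      (fun i hi => p.adj_getVert_succ (by omega)) ?_ ?_
    · intro i j hij hj heq
      have := hp.getVert_injOn (show i ∈ {i | i ≤ p.length} by simp; omega)
        (show j ∈ {i | i ≤ p.length} by simp; omega) heq
      omega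
    · intro i hi
      rw [hcol i (by omega), hcol (t.length + i) (by omega), List.getElem_append_left hi,
        List.getElem_append_right (by omega)]
      simp

/-! ### Sequences of colour sets without repetitions -/

/-- No path through the layers `0, …, N - 1` reads a repetition, where `X i` is the set of colors
on layer `i`. A vertex is a pair of a layer and a color in its set, and vertices in neighbouring
layers are adjacent. -/
def RepetitionFree {C : Type*} (N : ℕ) (X : ℕ → Finset C) : Prop :=
  ∀ (l : ℕ) (pos : ℕ → ℕ) (col : ℕ → C), 0 < l →
    (∀ i < 2 * l, pos i < N ∧ col i ∈ X (pos i)) →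
    (∀ i, i + 1 < 2 * l → pos (i + 1) = pos i + 1 ∨ pos i = pos (i + 1) + 1) →
    (∀ i j, i < j → j < 2 * l → pos i = pos j → col i ≠ col j) →
    ¬ ∀ i < l, col i = col (l + i)

theorem RepetitionFree.reverse {C : Type*} {N : ℕ} {X : ℕ → Finset C}
    (h : RepetitionFree N X) : RepetitionFree N fun i => X (N - 1 - i) := by
  intro l pos col hl hmem hadj hinj
  refine h l (fun i => N - 1 - pos i) col hl ?_ ?_ ?_
  · intro i hi
    have := hmem i hi
    exact ⟨by omega, this.2⟩
  · intro i hi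
    have h1 := (hmem i (by omega)).1
    have h2 := (hmem (i + 1) (by omega)).1
    have := hadj i hi
    omega
  · intro i j hij hj heq
    have h1 := (hmem i (by omega)).1
    have h2 := (hmem j hj).1
    exact hinj i j hij hj (by omega)

theorem RepetitionFree.shift {C : Type*} {N : ℕ} {X : ℕ → Finset C}
    (h : RepetitionFree N X) {a M : ℕ} (ha : a + M ≤ N) :
    RepetitionFree M fun i => X (a + i) := by
  intro l pos col hl hmem hadj hinj
  refine h l (fun i => a + pos i) col hl ?_ ?_ ?_
  · intro i hi
    have := hmem i hi
    exact ⟨by omega, this.2⟩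
  · intro i hi
    have := hadj i hi
    omega
  · intro i j hij hj heq
    exact hinj i j hij hj (by omega)

/-- The folded path of length `2 * l` with turn length `r`: it descends from `2 * l - 1 - r` to `0`
and then climbs back up to `r`. -/
def foldPos (l r j : ℕ) : ℕ :=
  if j ≤ 2 * l - 1 - r then 2 * l - 1 - r - j else j - (2 * l - 1 - r)

/-- A folded path yields a repetition as soon as its halves match and the two colors
used on each of the layers `1, …, r`, which are visited twice, are different. -/
theorem RepetitionFree.not_fold {C : Type*} {N : ℕ} {X : ℕ → Finset C}
    (h : RepetitionFree N X) (a l r : ℕ) (κ : ℕ → C) (hl : 2 * r < l)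
    (hN : a + (2 * l - r) ≤ N)
    (hκ : ∀ i < l, κ i ∈ X (a + foldPos l r i) ∧ κ i ∈ X (a + foldPos l r (l + i)))
    (hne : ∀ t, 1 ≤ t → t ≤ r → κ (l - 1 - r + t) ≠ κ (l - 1 - r - t)) : False := by
  refine h l (fun j => a + foldPos l r j) (fun j => if j < l then κ j else κ (j - l))
    (by omega) ?_ ?_ ?_ ?_
  · intro i hi
    refine ⟨by dsimp only [foldPos]; split_ifs <;> omega, ?_⟩
    split_ifs with hil
    · exact (hκ i hil).1
    · have := (hκ (i - l) (by omega)).2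
      rwa [show l + (i - l) = i by omega] at this
  · intro i hi
    dsimp only [foldPos]
    split_ifs <;> omega
  · intro i j hij hj heq
    -- Coinciding layers force `i` and `j` to be symmetric about the turning point.
    obtain ⟨t, ht1, htr, rfl, rfl⟩ : ∃ t, 1 ≤ t ∧ t ≤ r ∧ i = 2 * l - 1 - r - t ∧
        j = 2 * l - 1 - r + t := by
      refine ⟨j - (2 * l - 1 - r), ?_⟩
      dsimp only [foldPos] at heq
      split_ifs at heq <;> omega
    have := hne t ht1 htr
    rw [if_neg (by omega), if_neg (by omega),
      show 2 * l - 1 - r - t - l = l - 1 - r - t by omega,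
      show 2 * l - 1 - r + t - l = l - 1 - r + t by omega]
    exact this.symm
  · intro i hi
    rw [if_pos hi, if_neg (by omega), Nat.add_sub_cancel_left]

section Layers

variable {C : Type*} {N : ℕ} {X : ℕ → Finset C}

theorem RepetitionFree.disjoint_succ (h : RepetitionFree N X) (i : ℕ) (hi : i + 1 < N) :
    Disjoint (X i) (X (i + 1)) := by
  rw [Finset.disjoint_left]
  intro x h0 h1
  refine h.not_fold i 1 0 (fun _ => x) (by omega) (by omega) ?_ (by omega)
  intro j hj
  obtain rfl : j = 0 := by omega
  exact ⟨h1, h0⟩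

theorem RepetitionFree.not_two_square (h : RepetitionFree N X) (i : ℕ) (hi : i + 3 < N) {x y : C}
    (h0 : x ∈ X i) (h2 : x ∈ X (i + 2)) (h1 : y ∈ X (i + 1)) (h3 : y ∈ X (i + 3)) : False := by
  refine h.not_fold i 2 0 (fun j => if j = 0 then y else x) (by omega) (by omega) ?_ (by omega)
  intro j hj
  interval_cases j
  · exact ⟨h3, h1⟩
  · exact ⟨h2, h0⟩

theorem RepetitionFree.not_three_square (h : RepetitionFree N X) (i : ℕ) (hi : i + 5 < N)
    {x y z : C} (h0 : x ∈ X i) (h3 : x ∈ X (i + 3)) (h1 : y ∈ X (i + 1)) (h4 : y ∈ X (i + 4))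
    (h2 : z ∈ X (i + 2)) (h5 : z ∈ X (i + 5)) : False := by
  refine h.not_fold i 3 0 (fun j => if j = 0 then z else if j = 1 then y else x)
    (by omega) (by omega) ?_ (by omega)
  intro j hj
  interval_cases j
  · exact ⟨h5, h2⟩
  · exact ⟨h4, h1⟩
  · exact ⟨h3, h0⟩

end Layers

/-! ### Layers at distance two with at most `3 * k` colors -/

theorem mem_or_mem_or_mem_of_card_le {C : Type*} [Fintype C] {k : ℕ} {S T U : Finset C}
    (hC : Fintype.card C ≤ 3 * k) (hS : S.card = k) (hT : T.card = k) (hU : U.card = k)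
    (hST : Disjoint S T) (hSU : Disjoint S U) (hTU : Disjoint T U) (x : C) :
    x ∈ S ∨ x ∈ T ∨ x ∈ U := by
  classical
  have hcard : (S ∪ T ∪ U).card = 3 * k := by
    rw [Finset.card_union_of_disjoint (Finset.disjoint_union_left.2 ⟨hSU, hTU⟩),
      Finset.card_union_of_disjoint hST]
    omega
  have := (Finset.card_eq_iff_eq_univ (S ∪ T ∪ U)).1
    (le_antisymm (Finset.card_le_univ _) (by omega))
  have hx : x ∈ S ∪ T ∪ U := this ▸ Finset.mem_univ x
  simpa [or_assoc] using hx

/-- Two layers at distance two, with three layers before them and one after, are equal once they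
meet. Were they to meet without being equal, the layers `2, 3, 4` and `4, 5, 6` would partition the
colors, so that `2` meets `5` and `3` meets `6`. Now if `1` meets `4`, the layers `1, …, 6` contain
a square of period three. Otherwise layer `1` equals layer `3` and layer `0` equals layer `4`, and
the path that descends from `6` to `0` and steps back to `1` reads a repetition. -/
theorem RepetitionFree.eq_of_mem_of_mem {C : Type*} [Fintype C] {k : ℕ} {X : ℕ → Finset C}
    (h : RepetitionFree 7 X) (hC : Fintype.card C ≤ 3 * k) (hk : 2 ≤ k)
    (hX : ∀ i < 7, (X i).card = k) {z : C} (hz3 : z ∈ X 3) (hz5 : z ∈ X 5) : X 3 = X 5 := by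
  by_contra hne
  have hd : ∀ i, i < 6 → ∀ x, x ∈ X i → x ∉ X (i + 1) := fun i hi x hx =>
    Finset.disjoint_left.1 (h.disjoint_succ i (by omega)) hx
  have h24 : Disjoint (X 2) (X 4) := Finset.disjoint_left.2 fun x hx2 hx4 =>
    h.not_two_square 2 (by omega) hx2 hx4 hz3 hz5
  have h46 : Disjoint (X 4) (X 6) := Finset.disjoint_left.2 fun x hx4 hx6 =>
    h.not_two_square 3 (by omega) hz3 hz5 hx4 hx6
  have hpart (i : ℕ) (hi : i + 2 < 7) (hdis : Disjoint (X i) (X (i + 2))) (x : C) :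
      x ∈ X i ∨ x ∈ X (i + 1) ∨ x ∈ X (i + 2) :=
    mem_or_mem_or_mem_of_card_le hC (hX _ (by omega)) (hX _ (by omega)) (hX _ (by omega))
      (h.disjoint_succ _ (by omega)) hdis (h.disjoint_succ _ (by omega)) x
  have hp2 := hpart 2 (by omega) h24
  have hp4 := hpart 4 (by omega) h46
  have hsub {S T : Finset C} (hS : S.card = k) (hT : T.card = k) (hST : S ≠ T) :
      ∃ x ∈ S, x ∉ T := by
    by_contra! hcon
    exact hST (Finset.eq_of_subset_of_card_le hcon (by omega))
  obtain ⟨x, hx5, hx3⟩ := hsub (hX 5 (by omega)) (hX 3 (by omega)) (Ne.symm hne)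
  obtain ⟨y, hy3, hy5⟩ := hsub (hX 3 (by omega)) (hX 5 (by omega)) hne
  have hx2 : x ∈ X 2 := by
    have := hp2 x
    have := fun h4 => hd 4 (by omega) x h4 hx5
    tauto
  have hy6 : y ∈ X 6 := by
    have := hp4 y
    have := hd 3 (by omega) y hy3
    tauto
  -- `X 2` is not contained in `X 5`, as `z` lies in `X 5` but not in `X 2`.
  obtain ⟨u, hu2, hu5⟩ := hsub (hX 2 (by omega)) (hX 5 (by omega))
    fun he => hd 2 (by omega) z (he ▸ hz5) hz3
  have hu6 : u ∈ X 6 := by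
    have := hp4 u
    have := Finset.disjoint_left.1 h24 hu2
    tauto
  have h14 : ∀ v, v ∈ X 1 → v ∉ X 4 := fun v hv1 hv4 =>
    h.not_three_square 1 (by omega) hv1 hv4 hx2 hx5 hy3 hy6
  have h13 : X 1 = X 3 := by
    refine Finset.eq_of_subset_of_card_le (fun v hv => ?_) (by rw [hX 1, hX 3] <;> omega)
    have := hp2 v
    have := hd 1 (by omega) v hv
    have := h14 v hv
    tauto
  have hz1 : z ∈ X 1 := h13 ▸ hz3
  obtain ⟨e, he0⟩ : (X 0).Nonempty := Finset.card_pos.1 (by rw [hX 0] <;> omega)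
  have he4 : e ∈ X 4 := by
    have h2 : e ∉ X 2 := fun h2 => h.not_two_square 0 (by omega) he0 h2 hz1 hz3
    have h3 : e ∉ X 3 := h13 ▸ hd 0 (by omega) e he0
    have := hp2 e
    tauto
  obtain ⟨b, hb3, hbz⟩ : ∃ b ∈ X 3, b ≠ z :=
    Finset.exists_mem_ne (by rw [hX 3] <;> omega) z
  have hb1 : b ∈ X 1 := h13 ▸ hb3
  refine h.not_fold 0 4 1
    (fun j => if j = 0 then u else if j = 1 then z else if j = 2 then e else b)
    (by omega) (by omega) ?_ ?_
  · intro j hj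
    interval_cases j
    · exact ⟨hu6, hu2⟩
    · exact ⟨hz5, hz1⟩
    · exact ⟨he4, he0⟩
    · exact ⟨hb3, hb1⟩
  · intro t h1 h2
    obtain rfl : t = 1 := by omega
    simpa using hbz

/-! ### Ternary words of length 22 -/

/-- The word `v` has matching halves along the path of length `2 * l` with turn length `r` folded at
its first letter. -/
def foldMatches (v : List (Fin 3)) (l r : ℕ) : Bool :=
  decide (2 * l - r ≤ v.length) &&
    (List.range l).all fun i =>
      decide (v.getD (foldPos l r i) 0 = v.getD (foldPos l r (l + i)) 0)

/-- Pairs `(l, r)` such that matching along one of the corresponding folded paths is unavoidable in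
ternary words of length 22. -/
def unavoidableFolds : List (ℕ × ℕ) :=
  [(1, 0), (2, 0), (3, 0), (4, 1), (4, 0), (6, 2), (8, 1), (8, 2), (8, 3)]

/-- Whether each extension of `v` to the left by `d` letters has a suffix, at least as long as
`v`, that matches along an unavoidable folded path. -/
def foldSearch : ℕ → List (Fin 3) → Bool
  | 0, v => unavoidableFolds.any fun q => foldMatches v q.1 q.2
  | d + 1, v => (unavoidableFolds.any fun q => foldMatches v q.1 q.2) ||
      (foldSearch d (0 :: v) && foldSearch d (1 :: v) && foldSearch d (2 :: v))

theorem foldSearch_nil : foldSearch 22 [] = true := by decide +kernel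

theorem exists_foldMatches_of_foldSearch (g : ℕ → Fin 3) (N d : ℕ) (hd : d ≤ N)
    (h : foldSearch d ((List.range (N - d)).map fun t => g (d + t)) = true) :
    ∃ a ≤ d, ∃ q ∈ unavoidableFolds,
      foldMatches ((List.range (N - a)).map fun t => g (a + t)) q.1 q.2 = true := by
  induction d with
  | zero =>
    simp only [foldSearch, List.any_eq_true] at h
    exact ⟨0, le_rfl, h⟩
  | succ d ih =>
    simp only [foldSearch, Bool.or_eq_true, Bool.and_eq_true, List.any_eq_true] at h
    rcases h with h | ⟨⟨h0, h1⟩, h2⟩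
    · exact ⟨d + 1, le_rfl, h⟩
    · have hcons : ((List.range (N - d)).map fun t => g (d + t)) =
          g d :: (List.range (N - (d + 1))).map fun t => g (d + 1 + t) := by
        rw [show N - d = N - (d + 1) + 1 by omega, List.range_succ_eq_map]
        simp [Function.comp_def, add_left_comm, add_comm]
      obtain ⟨a, ha, hq⟩ := ih (by omega) (by
        rw [hcons]
        generalize g d = x
        fin_cases x <;> assumption)
      exact ⟨a, by omega, hq⟩

theorem exists_fold_of_ternary (g : ℕ → Fin 3) :
    ∃ a l r, 2 * r < l ∧ a + (2 * l - r) ≤ 22 ∧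
      ∀ i < l, g (a + foldPos l r i) = g (a + foldPos l r (l + i)) := by
  obtain ⟨a, ha, ⟨l, r⟩, hq, hm⟩ := exists_foldMatches_of_foldSearch g 22 22 le_rfl
    (by simpa using foldSearch_nil)
  have hlr : 2 * r < l := by
    simp only [unavoidableFolds, List.mem_cons, Prod.mk.injEq, List.not_mem_nil, or_false] at hq
    omega
  simp only [foldMatches, Bool.and_eq_true, decide_eq_true_eq, List.length_map, List.length_range,
    List.all_eq_true, List.mem_range] at hm
  refine ⟨a, l, r, hlr, by omega, fun i hi => ?_⟩
  have hlt : ∀ j < 2 * l, foldPos l r j < 22 - a := by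
    intro j hj
    unfold foldPos
    split_ifs <;> omega
  have := hm.2 i hi
  rwa [List.getD_eq_getElem _ _ (by simpa using hlt i (by omega)),
    List.getD_eq_getElem _ _ (by simpa using hlt (l + i) (by omega)), List.getElem_map,
    List.getElem_map, List.getElem_range, List.getElem_range] at this

/-! ### The lower bound -/

/-- If layers at distance two are equal or disjoint, then the layers form a ternary word over
three disjoint color sets. -/
theorem RepetitionFree.exists_ternary {C : Type*} [Fintype C] {k N : ℕ} {X : ℕ → Finset C}
    (h : RepetitionFree N X) (hN : 4 ≤ N) (hk : 0 < k) (hC : Fintype.card C ≤ 3 * k)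
    (hX : ∀ i < N, (X i).card = k)
    (hpure : ∀ i, i + 2 < N → X i = X (i + 2) ∨ Disjoint (X i) (X (i + 2))) :
    ∃ (S : Fin 3 → Finset C) (g : ℕ → Fin 3), ∀ i < N, X i = S (g i) := by
  -- One of the triples `0, 1, 2` and `1, 2, 3` partitions the colors.
  obtain ⟨o, ho, hdis, ho0⟩ : ∃ o, o + 3 ≤ N ∧ Disjoint (X o) (X (o + 2)) ∧
      (o = 0 ∨ X 0 = X 2 ∧ o = 1) := by
    by_cases h0 : Disjoint (X 0) (X 2)
    · exact ⟨0, by omega, h0, Or.inl rfl⟩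
    · obtain ⟨x, hx0, hx2⟩ := Finset.not_disjoint_iff.1 h0
      refine ⟨1, by omega, Finset.disjoint_left.2 fun y hy1 hy3 => ?_,
        Or.inr ⟨(hpure 0 (by omega)).resolve_right h0, rfl⟩⟩
      exact h.not_two_square 0 (by omega) hx0 hx2 hy1 hy3
  let S : Fin 3 → Finset C := ![X o, X (o + 1), X (o + 2)]
  have hS0 : X o = S 0 := rfl
  have hS1 : X (o + 1) = S 1 := rfl
  have hS2 : X (o + 2) = S 2 := rfl
  have hcov (x : C) : ∃ s, x ∈ S s := by
    rcases mem_or_mem_or_mem_of_card_le hC (hX o (by omega)) (hX (o + 1) (by omega))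
      (hX (o + 2) (by omega)) (h.disjoint_succ _ (by omega)) hdis
      (h.disjoint_succ _ (by omega)) x with hx | hx | hx
    exacts [⟨0, hx⟩, ⟨1, hx⟩, ⟨2, hx⟩]
  have hScard (s : Fin 3) : (S s).card = k := by
    fin_cases s
    exacts [hX _ (by omega), hX _ (by omega), hX _ (by omega)]
  have key : ∀ j, o + j + 1 < N → (∃ s, X (o + j) = S s) ∧ ∃ s, X (o + j + 1) = S s := by
    intro j
    induction j with
    | zero => exact fun _ => ⟨⟨0, hS0⟩, ⟨1, hS1⟩⟩
    | succ j ih =>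
      intro hj
      obtain ⟨⟨s, hs⟩, ⟨t, ht⟩⟩ := ih (by omega)
      refine ⟨⟨t, ht⟩, ?_⟩
      rcases hpure (o + j) (by omega) with he | hd
      · exact ⟨s, he.symm.trans hs⟩
      · have hst := h.disjoint_succ (o + j) (by omega)
        have htu := h.disjoint_succ (o + j + 1) (by omega)
        obtain ⟨u, hu⟩ : ∃ u : Fin 3, ∀ v, v = s ∨ v = t ∨ v = u := by
          have : s ≠ t := by
            rintro rfl
            rw [hs, ht, disjoint_self, Finset.bot_eq_empty, ← Finset.card_eq_zero, hScard] at hst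
            omega
          clear_value S
          clear * - this
          decide +revert
        refine ⟨u, Finset.eq_of_subset_of_card_le (fun x hx => ?_)
          (by rw [hScard, hX _ (by omega)])⟩
        obtain ⟨v, hv⟩ := hcov x
        rcases hu v with rfl | rfl | rfl
        · exact absurd hx (Finset.disjoint_left.1 hd (hs ▸ hv))
        · exact absurd hx (Finset.disjoint_left.1 htu (ht ▸ hv))
        · exact hv
  have hall : ∀ i, ∃ s, i < N → X i = S s := by
    intro i
    by_cases hi : i < N
    · by_cases hio : o ≤ i
      · rcases Nat.lt_or_ge (i + 1) N with hi1 | hi1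
        · obtain ⟨s, hs⟩ := (key (i - o) (by omega)).1
          exact ⟨s, fun _ => by rw [← hs]; congr 1; omega⟩
        · obtain ⟨s, hs⟩ := (key (i - 1 - o) (by omega)).2
          exact ⟨s, fun _ => by rw [← hs]; congr 1; omega⟩
      · obtain ⟨h02, rfl⟩ := ho0.resolve_left (by omega)
        obtain rfl : i = 0 := by omega
        exact ⟨1, fun _ => h02⟩
    · exact ⟨0, fun h => absurd h hi⟩
  choose g hg using hall
  exact ⟨S, g, fun i hi => hg i hi⟩

theorem RepetitionFree.eq_or_disjoint {C : Type*} [Fintype C] {k N : ℕ} {X : ℕ → Finset C}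
    (h : RepetitionFree N X) (hN : 8 ≤ N) (hC : Fintype.card C ≤ 3 * k) (hk : 2 ≤ k)
    (hX : ∀ i < N, (X i).card = k) (i : ℕ) (hi : 1 ≤ i) (hiN : i + 3 < N) :
    X i = X (i + 2) ∨ Disjoint (X i) (X (i + 2)) := by
  by_cases hdis : Disjoint (X i) (X (i + 2))
  · exact Or.inr hdis
  left
  obtain ⟨z, hz0, hz2⟩ := Finset.not_disjoint_iff.1 hdis
  by_cases hi3 : 3 ≤ i
  · have := (h.shift (a := i - 3) (M := 7) (by omega)).eq_of_mem_of_mem hC hk (z := z)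
      (fun j hj => hX _ (by omega))
    simp only [show i - 3 + 3 = i by omega, show i - 3 + 5 = i + 2 by omega] at this
    exact this hz0 hz2
  · -- Three layers follow, so the statement applies to the reversed sequence.
    have := (h.reverse.shift (a := N - 6 - i) (M := 7) (by omega)).eq_of_mem_of_mem hC hk (z := z)
      (fun j hj => hX _ (by omega))
    simp only [show N - 1 - (N - 6 - i + 3) = i + 2 by omega,
      show N - 1 - (N - 6 - i + 5) = i by omega] at this
    exact (this hz2 hz0).symm

theorem RepetitionFree.three_mul_lt_card {C : Type*} [Fintype C] {k N : ℕ} {X : ℕ → Finset C}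
    (h : RepetitionFree N X) (hN : 24 ≤ N) (hk : 2 ≤ k) (hX : ∀ i < N, (X i).card = k) :
    3 * k < Fintype.card C := by
  by_contra! hC
  have hY := h.shift (a := 1) (M := 22) (by omega)
  obtain ⟨S, g, hg⟩ := hY.exists_ternary (by omega) (by omega) hC (fun i hi => hX _ (by omega))
    fun i hi => h.eq_or_disjoint (by omega) hC hk hX (1 + i) (by omega) (by omega)
  obtain ⟨a, l, r, hlr, haN, hfold⟩ := exists_fold_of_ternary g
  have hlt : ∀ j < 2 * l, a + foldPos l r j < 22 := by
    intro j hj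
    unfold foldPos
    split_ifs <;> omega
  -- Two colors from each set suffice, since every layer is visited at most twice.
  have htwo (s : Fin 3) : ∃ x y, (∃ i < 22, g i = s) → x ∈ S s ∧ y ∈ S s ∧ x ≠ y := by
    by_cases hs : ∃ i < 22, g i = s
    · obtain ⟨i, hi, rfl⟩ := hs
      have : 1 < (S (g i)).card := by
        rw [← hg i hi, hX _ (by omega)]
        omega
      obtain ⟨x, hx, y, hy, hxy⟩ := Finset.one_lt_card.1 this
      exact ⟨x, y, fun _ => ⟨hx, hy, hxy⟩⟩
    · obtain ⟨x, -⟩ : (X 0).Nonempty := Finset.card_pos.1 (by rw [hX 0 (by omega)]; omega)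
      exact ⟨x, x, fun h => absurd h hs⟩
  choose x y hxy using htwo
  have hin (j : ℕ) (hj : j < 2 * l) := hxy (g (a + foldPos l r j)) ⟨_, hlt j hj, rfl⟩
  refine hY.not_fold a l r (fun i => if l - r ≤ i then y (g (a + foldPos l r (l + i)))
    else x (g (a + foldPos l r (l + i)))) hlr haN ?_ ?_
  · intro i hi
    rw [hg _ (hlt i (by omega)), hg _ (hlt (l + i) (by omega)), hfold i hi, and_self]
    split_ifs
    · exact (hin (l + i) (by omega)).2.1
    · exact (hin (l + i) (by omega)).1
  · intro t ht1 htr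
    rw [if_pos (by omega), if_neg (by omega)]
    have hpos : foldPos l r (l + (l - 1 - r - t)) = foldPos l r (l + (l - 1 - r + t)) := by
      unfold foldPos
      split_ifs <;> omega
    rw [hpos]
    exact (hin (l + (l - 1 - r + t)) (by omega)).2.2.symm

/-- The color sets of the layers of a path form a repetition-free sequence. -/
theorem IsRainbowNonrepetitive.repetitionFree {n k m : ℕ} {c : Fin n × Fin k → Fin m}
    (hc : IsRainbowNonrepetitive (SimpleGraph.pathGraph n) (⊥ : SimpleGraph (Fin k)) c) :
    RepetitionFree n fun i =>
      if h : i < n then Finset.univ.image fun w => c (⟨i, h⟩, w) else ∅ := by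
  intro l pos col hl hmem hadj hinj hrep
  have hex (i : ℕ) (hi : i < 2 * l) : ∃ v : Fin n × Fin k, v.1.val = pos i ∧ c v = col i := by
    obtain ⟨hp, hcol⟩ := hmem i hi
    simp only [dif_pos hp] at hcol
    obtain ⟨w, -, hw⟩ := Finset.mem_image.1 hcol
    exact ⟨(⟨pos i, hp⟩, w), rfl, hw⟩
  obtain ⟨v₀, -⟩ := hex 0 (by omega)
  have hex' (i : ℕ) : ∃ v : Fin n × Fin k, i < 2 * l → v.1.val = pos i ∧ c v = col i := by
    by_cases hi : i < 2 * l
    · exact (hex i hi).imp fun v hv _ => hv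
    · exact ⟨v₀, fun h => absurd h hi⟩
  choose f hf using hex'
  refine (isNonrepetitive_iff _ c).1 hc.1 l f hl ?_ ?_ ?_
  · intro i hi
    have h1 := (hf i (by omega)).1
    have h2 := (hf (i + 1) hi).1
    have := hadj i hi
    left
    rw [SimpleGraph.pathGraph_adj]
    omega
  · intro i j hij hj heq
    obtain ⟨h1, h2⟩ := hf i (by omega)
    obtain ⟨h3, h4⟩ := hf j hj
    exact hinj i j hij hj (by rw [← h1, ← h3, heq]) (by rw [← h2, ← h4, heq])
  · intro i hi
    rw [(hf i (by omega)).2, (hf (l + i) (by omega)).2]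
    exact hrep i hi

theorem IsRainbowNonrepetitive.three_mul_lt {n k m : ℕ} {c : Fin n × Fin k → Fin m}
    (hc : IsRainbowNonrepetitive (SimpleGraph.pathGraph n) (⊥ : SimpleGraph (Fin k)) c)
    (hn : 24 ≤ n) (hk : 2 ≤ k) : 3 * k < m := by
  have := hc.repetitionFree.three_mul_lt_card hn hk fun i hi => by
    rw [dif_pos hi, Finset.card_image_of_injective _ (hc.2 _), Finset.card_univ, Fintype.card_fin]
  rwa [Fintype.card_fin] at this

/-! ### A squarefree word over four letters without palindromes -/

/-- The block of length 13 that generates `digitSumWord`. -/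
def digitWeight (r : ℕ) : Fin 4 :=
  [0, 1, 2, 3, 0, 2, 3, 1, 2, 0, 1, 3, 0].getD r 0

/-- The sum modulo 4 of the weights of the base-13 digits of `n`. Equivalently, the fixed point of
the morphism that sends a letter `a` to the block `digitWeight` with `a` added to each letter. -/
def digitSumWord (n : ℕ) : Fin 4 :=
  ((Nat.digits 13 n).map digitWeight).sum

theorem digitSumWord_mul_add (n : ℕ) {r : ℕ} (hr : r < 13) :
    digitSumWord (13 * n + r) = digitWeight r + digitSumWord n := by
  rcases Nat.eq_zero_or_pos (13 * n + r) with h | h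
  · obtain ⟨rfl, rfl⟩ : n = 0 ∧ r = 0 := by omega
    decide
  · rw [digitSumWord, Nat.digits_def' (by norm_num) h, List.map_cons, List.sum_cons,
      show (13 * n + r) % 13 = r by omega, show (13 * n + r) / 13 = n by omega, digitSumWord]

theorem digitSumWord_mul (n : ℕ) : digitSumWord (13 * n) = digitSumWord n := by
  have := digitSumWord_mul_add n (r := 0) (by norm_num)
  rwa [show digitWeight 0 = 0 from rfl, zero_add, add_zero] at this

theorem digitSumWord_succ (n : ℕ) :
    digitSumWord (n + 1) = digitSumWord n + 1 ∨ digitSumWord (n + 1) = digitSumWord n + 2 := by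
  induction n using Nat.strong_induction_on with
  | _ n ih =>
    obtain ⟨q, r, hr, rfl⟩ : ∃ q r, r < 13 ∧ n = 13 * q + r :=
      ⟨n / 13, n % 13, Nat.mod_lt _ (by norm_num), by omega⟩
    rcases Nat.lt_or_ge r 12 with h | h
    · rw [add_assoc, digitSumWord_mul_add q hr, digitSumWord_mul_add q (by omega : r + 1 < 13)]
      generalize digitSumWord q = a
      revert a
      interval_cases r <;> decide
    · obtain rfl : r = 12 := by omega
      rw [digitSumWord_mul_add q hr, show 13 * q + 12 + 1 = 13 * (q + 1) by ring,
        digitSumWord_mul, show digitWeight 12 = 0 from rfl, zero_add]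
      exact ih q (by omega)

/-- The letter at position `j < 39` of three consecutive blocks of length 13, generated by the
letters `a`, `b`, `c`. -/
def threeBlocks (a b c : Fin 4) (j : ℕ) : Fin 4 :=
  digitWeight (j % 13) + if j < 13 then a else if j < 26 then b else c

theorem digitSumWord_eq_threeBlocks (q j : ℕ) (hj : j < 39) :
    digitSumWord (13 * q + j) =
      threeBlocks (digitSumWord q) (digitSumWord (q + 1)) (digitSumWord (q + 2)) j := by
  have h := digitSumWord_mul_add (q + j / 13) (r := j % 13) (Nat.mod_lt _ (by norm_num))
  rw [show 13 * (q + j / 13) + j % 13 = 13 * q + j by omega] at h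
  rw [h, threeBlocks]
  congr 1
  split_ifs
  · rw [show j / 13 = 0 by omega, add_zero]
  · rw [show j / 13 = 1 by omega]
  · rw [show j / 13 = 2 by omega]

theorem exists_threeBlocks_ne : ∀ a b c : Fin 4, (b = a + 1 ∨ b = a + 2) →
    (c = b + 1 ∨ c = b + 2) → ∀ r < 13, ∀ d < 13, 0 < d →
    ∃ j < d, threeBlocks a b c (r + j) ≠ threeBlocks a b c (r + j + d) := by
  decide +kernel

theorem threeBlocks_ne_add_two : ∀ a b c : Fin 4, (b = a + 1 ∨ b = a + 2) →
    ∀ r < 13, threeBlocks a b c r ≠ threeBlocks a b c (r + 2) := by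
  decide +kernel

theorem digitSumWord_ne_succ (n : ℕ) : digitSumWord n ≠ digitSumWord (n + 1) := by
  rcases digitSumWord_succ n with h | h <;> rw [h] <;> generalize digitSumWord n = a <;>
    revert a <;> decide

theorem digitSumWord_ne_add_two (n : ℕ) : digitSumWord n ≠ digitSumWord (n + 2) := by
  obtain ⟨q, r, hr, rfl⟩ : ∃ q r, r < 13 ∧ n = 13 * q + r :=
    ⟨n / 13, n % 13, Nat.mod_lt _ (by norm_num), by omega⟩
  rw [add_assoc, digitSumWord_eq_threeBlocks q r (by omega),
    digitSumWord_eq_threeBlocks q (r + 2) (by omega)]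
  exact threeBlocks_ne_add_two _ _ _ (digitSumWord_succ q) r hr

theorem exists_digitWeight_step_ne : ∀ s < 13, 0 < s → ∃ r < 12, (r + s) % 13 < 12 ∧
    digitWeight (r + 1) - digitWeight r ≠
      digitWeight ((r + s) % 13 + 1) - digitWeight ((r + s) % 13) := by
  decide

/-- The word is squarefree. A square whose period is a multiple of 13 gives a shorter one, by reading
the first letters of the blocks. For other periods above 13 the increments inside blocks do not fit
together, and the small periods concern three consecutive blocks only. -/
theorem exists_digitSumWord_ne (d : ℕ) (hd : 0 < d) (i : ℕ) :
    ∃ j < d, digitSumWord (i + j) ≠ digitSumWord (i + j + d) := by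
  induction d using Nat.strong_induction_on generalizing i with
  | _ d ih =>
    by_cases hdvd : 13 ∣ d
    · obtain ⟨e, rfl⟩ := hdvd
      obtain ⟨j, hj, hne⟩ := ih e (by omega) (by omega) ((i + 12) / 13)
      refine ⟨13 * ((i + 12) / 13 + j) - i, by omega, ?_⟩
      rw [show i + (13 * ((i + 12) / 13 + j) - i) = 13 * ((i + 12) / 13 + j) by omega, ← mul_add,
        digitSumWord_mul, digitSumWord_mul]
      exact hne
    · rcases Nat.lt_or_ge d 13 with hlt | hge
      · obtain ⟨q, r, hr, rfl⟩ : ∃ q r, r < 13 ∧ i = 13 * q + r :=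
          ⟨i / 13, i % 13, Nat.mod_lt _ (by norm_num), by omega⟩
        obtain ⟨j, hj, hne⟩ := exists_threeBlocks_ne _ _ _ (digitSumWord_succ q)
          (digitSumWord_succ (q + 1)) r hr d hlt hd
        refine ⟨j, hj, ?_⟩
        rwa [show 13 * q + r + j = 13 * q + (r + j) by ring,
          show 13 * q + (r + j) + d = 13 * q + (r + j + d) by ring,
          digitSumWord_eq_threeBlocks q _ (by omega), digitSumWord_eq_threeBlocks q _ (by omega)]
      · by_contra! hall
        obtain ⟨r, hr, hrs, hne⟩ :=
          exists_digitWeight_step_ne (d % 13) (Nat.mod_lt _ (by norm_num)) (by omega)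
        obtain ⟨q, hq⟩ : ∃ q, i ≤ 13 * q + r ∧ 13 * q + r ≤ i + 12 :=
          ⟨(i + 12 - r) / 13, by omega⟩
        obtain ⟨q', hq'⟩ : ∃ q', 13 * q + r + d = 13 * q' + (r + d % 13) % 13 :=
          ⟨(13 * q + r + d) / 13, by omega⟩
        have h0 := hall (13 * q + r - i) (by omega)
        have h1 := hall (13 * q + r + 1 - i) (by omega)
        rw [show i + (13 * q + r - i) = 13 * q + r by omega, hq', digitSumWord_mul_add q (by omega),
          digitSumWord_mul_add q' (by omega)] at h0
        rw [show i + (13 * q + r + 1 - i) = 13 * q + (r + 1) by omega,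
          show 13 * q + (r + 1) + d = 13 * q' + ((r + d % 13) % 13 + 1) by omega,
          digitSumWord_mul_add q (by omega), digitSumWord_mul_add q' (by omega)] at h1
        have := congrArg₂ (· - ·) h1 h0
        simp only [add_sub_add_right_eq_sub] at this
        exact hne this

/-! ### Lazy walks on squarefree words without palindromes -/

theorem exists_eq_of_le_of_le (e : ℕ → ℕ) (n x : ℕ)
    (he : ∀ i < n, e (i + 1) ≤ e i + 1) (h0 : e 0 ≤ x) (hn : x ≤ e n) : ∃ i ≤ n, e i = x := by
  induction n with
  | zero => exact ⟨0, le_rfl, by omega⟩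
  | succ n ih =>
    by_cases hx : x ≤ e n
    · obtain ⟨i, hi, h⟩ := ih (fun i hi => he i (by omega)) hx
      exact ⟨i, by omega, h⟩
    · exact ⟨n + 1, le_rfl, by have := he n (by omega); omega⟩

section LazyWalk

variable {α : Type*} {lab : ℕ → α}

/-- Positions `a`, `b` have a pair of equally labelled neighbours on the same side. -/
def HasDirectStep (lab : ℕ → α) (a b : ℕ) : Prop :=
  lab (a + 1) = lab (b + 1) ∨ ∃ a' b', a = a' + 1 ∧ b = b' + 1 ∧ lab a' = lab b'

/-- Positions `a`, `b` have a pair of equally labelled neighbours on opposite sides. -/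
def HasMirrorStep (lab : ℕ → α) (a b : ℕ) : Prop :=
  (∃ b', b = b' + 1 ∧ lab (a + 1) = lab b') ∨ ∃ a', a = a' + 1 ∧ lab a' = lab (b + 1)

theorem HasDirectStep.not_hasMirrorStep (h2 : ∀ n, lab n ≠ lab (n + 2)) {a b : ℕ}
    (hd : HasDirectStep lab a b) : ¬ HasMirrorStep lab a b := by
  rcases hd with hd | ⟨a', b', rfl, rfl, hd⟩
  · rintro (⟨b', rfl, hm⟩ | ⟨a', rfl, hm⟩)
    · exact h2 b' (hm.symm.trans hd)
    · exact h2 a' (hm.trans hd.symm)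
  · rintro (⟨b'', hb, hm⟩ | ⟨a'', ha, hm⟩)
    · obtain rfl : b' = b'' := by omega
      exact h2 a' (hd.trans hm.symm)
    · obtain rfl : a' = a'' := by omega
      exact h2 b' (hd.symm.trans hm)

/-- On a word without equal neighbours, two lazy walkers that always read the same letter rest at
the same times and otherwise step both in the same or both in opposite directions. -/
theorem lazy_step_cases (h1 : ∀ n, lab n ≠ lab (n + 1)) {a b a' b' : ℕ}
    (ha : a' ≤ a + 1 ∧ a ≤ a' + 1) (hb : b' ≤ b + 1 ∧ b ≤ b' + 1)
    (h : lab a = lab b) (h' : lab a' = lab b') :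
    (a' = a ∧ b' = b) ∨
      (a' + b = a + b' ∧ HasDirectStep lab a b ∧ HasDirectStep lab a' b') ∨
      (a' + b' = a + b ∧ HasMirrorStep lab a b ∧ HasMirrorStep lab a' b') := by
  obtain rfl | rfl | rfl : a' = a ∨ a' = a + 1 ∨ a = a' + 1 := by omega
  · obtain rfl | rfl | rfl : b' = b ∨ b' = b + 1 ∨ b = b' + 1 := by omega
    · exact Or.inl ⟨rfl, rfl⟩
    · exact absurd (h.symm.trans h') (h1 b)
    · exact absurd (h'.symm.trans h) (h1 b')
  · obtain rfl | rfl | rfl : b' = b ∨ b' = b + 1 ∨ b = b' + 1 := by omega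
    · exact absurd (h.trans h'.symm) (h1 a)
    · exact Or.inr (Or.inl ⟨by omega, Or.inl h', Or.inr ⟨a, b, rfl, rfl, h⟩⟩)
    · exact Or.inr (Or.inr ⟨by omega, Or.inl ⟨b', rfl, h'⟩, Or.inr ⟨a, rfl, h⟩⟩)
  · obtain rfl | rfl | rfl : b' = b ∨ b' = b + 1 ∨ b = b' + 1 := by omega
    · exact absurd (h'.trans h.symm) (h1 a')
    · exact Or.inr (Or.inr ⟨by omega, Or.inr ⟨a', rfl, h'⟩, Or.inl ⟨b, rfl, h⟩⟩)
    · exact Or.inr (Or.inl ⟨by omega, Or.inr ⟨a', b', rfl, rfl, h'⟩, Or.inl h⟩)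

/-- On a word without palindromes, two lazy walkers that always read the same letter keep either
their difference or their sum. -/
theorem lazy_walk_cases (h1 : ∀ n, lab n ≠ lab (n + 1)) (h2 : ∀ n, lab n ≠ lab (n + 2))
    {r : ℕ} {e f : ℕ → ℕ} (he : ∀ i, i + 1 < r → e (i + 1) ≤ e i + 1 ∧ e i ≤ e (i + 1) + 1)
    (hf : ∀ i, i + 1 < r → f (i + 1) ≤ f i + 1 ∧ f i ≤ f (i + 1) + 1)
    (hlab : ∀ i < r, lab (e i) = lab (f i)) :
    (∀ i < r, e i + f 0 = e 0 + f i) ∨ ∀ i < r, e i + f i = e 0 + f 0 := by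
  have key : ∀ n < r, (∀ i ≤ n, e i = e 0 ∧ f i = f 0) ∨
      ((∀ i ≤ n, e i + f 0 = e 0 + f i) ∧ HasDirectStep lab (e n) (f n)) ∨
      ((∀ i ≤ n, e i + f i = e 0 + f 0) ∧ HasMirrorStep lab (e n) (f n)) := by
    intro n
    induction n with
    | zero =>
      intro _
      refine Or.inl fun i hi => ?_
      obtain rfl : i = 0 := by omega
      exact ⟨rfl, rfl⟩
    | succ n ih =>
      intro hn
      have hext {P : ℕ → Prop} (hP : ∀ i ≤ n, P i) (hP' : P (n + 1)) : ∀ i ≤ n + 1, P i := by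
        intro i hi
        rcases Nat.le_succ_iff.1 hi with h | rfl
        exacts [hP i h, hP']
      rcases lazy_step_cases h1 (he n hn) (hf n hn) (hlab n (by omega)) (hlab (n + 1) hn) with
        ⟨hs1, hs2⟩ | ⟨hs, hd, hd'⟩ | ⟨hs, hm, hm'⟩
      · rw [hs1, hs2]
        rcases ih (by omega) with h | ⟨h, hd⟩ | ⟨h, hm⟩
        · exact Or.inl (hext h (by rw [hs1, hs2]; exact h n le_rfl))
        · exact Or.inr (Or.inl ⟨hext h (by rw [hs1, hs2]; exact h n le_rfl), hd⟩)
        · exact Or.inr (Or.inr ⟨hext h (by rw [hs1, hs2]; exact h n le_rfl), hm⟩)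
      · refine Or.inr (Or.inl ⟨?_, hd'⟩)
        rcases ih (by omega) with h | ⟨h, -⟩ | ⟨-, hm⟩
        · exact hext (fun i hi => by have := h i hi; omega) (by have := h n le_rfl; omega)
        · exact hext h (by have := h n le_rfl; omega)
        · exact absurd hm (hd.not_hasMirrorStep h2)
      · refine Or.inr (Or.inr ⟨?_, hm'⟩)
        rcases ih (by omega) with h | ⟨-, hd⟩ | ⟨h, -⟩
        · exact hext (fun i hi => by have := h i hi; omega) (by have := h n le_rfl; omega)
        · exact absurd hm (hd.not_hasMirrorStep h2)
        · exact hext h (by have := h n le_rfl; omega)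
  rcases Nat.eq_zero_or_pos r with rfl | hr
  · exact Or.inl fun i hi => absurd hi (Nat.not_lt_zero i)
  · rcases key (r - 1) (by omega) with h | ⟨h, -⟩ | ⟨h, -⟩
    · exact Or.inl fun i hi => by have := h i (by omega); omega
    · exact Or.inl fun i hi => h i (by omega)
    · exact Or.inr fun i hi => h i (by omega)

/-- A lazy walk `e 0, …, e (r - 1), f 0, …, f (r - 1)` on a squarefree word without palindromes
that reads a repetition visits some position at the same time in both halves. -/
theorem not_lazy_walk (h1 : ∀ n, lab n ≠ lab (n + 1)) (h2 : ∀ n, lab n ≠ lab (n + 2))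
    (hsq : ∀ d, 0 < d → ∀ i, ∃ j < d, lab (i + j) ≠ lab (i + j + d))
    {r : ℕ} (hr : 0 < r) {e f : ℕ → ℕ}
    (he : ∀ i, i + 1 < r → e (i + 1) ≤ e i + 1 ∧ e i ≤ e (i + 1) + 1)
    (hf : ∀ i, i + 1 < r → f (i + 1) ≤ f i + 1 ∧ f i ≤ f (i + 1) + 1)
    (hef : f 0 ≤ e (r - 1) + 1 ∧ e (r - 1) ≤ f 0 + 1)
    (hlab : ∀ i < r, lab (e i) = lab (f i)) (hne : ∀ i < r, e i ≠ f i) : False := by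
  have hne0 := hne 0 hr
  rcases lazy_walk_cases h1 h2 he hf hlab with hdir | hmir
  · -- The walk `e` comes within distance one of `f 0`, so it traverses one half of a square.
    rcases lt_or_gt_of_ne hne0 with hlt | hlt
    · obtain ⟨j, hj, hjne⟩ := hsq (f 0 - e 0) (by omega) (e 0)
      obtain ⟨i, hi, hie⟩ := exists_eq_of_le_of_le e (r - 1) (e 0 + j)
        (fun i hi => (he i (by omega)).1) (by omega) (by omega)
      have h3 := hdir i (by omega)
      have h4 := hlab i (by omega)
      rw [hie, show f i = e 0 + j + (f 0 - e 0) by omega] at h4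
      exact hjne h4
    · have hdlast := hdir (r - 1) (by omega)
      have hback (x : ℕ) (hx : x ≤ e 0) (hx' : e (r - 1) ≤ x) : ∃ i < r, e i = x := by
        obtain ⟨i, hi, hie⟩ := exists_eq_of_le_of_le (fun i => e (r - 1 - i)) (r - 1) x
          (fun i hi => by
            have := (he (r - 1 - (i + 1)) (by omega)).2
            rwa [show r - 1 - (i + 1) + 1 = r - 1 - i by omega] at this)
          (by simpa using hx') (by simpa using hx)
        exact ⟨r - 1 - i, by omega, hie⟩
      obtain ⟨i₀, hi₀, hie₀⟩ := hback (f 0 + 1) (by omega) (by omega)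
      have h3 := hdir i₀ hi₀
      obtain ⟨j, hj, hjne⟩ := hsq (e 0 - f 0) (by omega) (f i₀)
      obtain ⟨i, hi, hie⟩ := hback (f 0 + 1 + j) (by omega) (by omega)
      have h4 := hdir i hi
      have h5 := hlab i hi
      rw [show e i = f i₀ + j + (e 0 - f 0) by omega, show f i = f i₀ + j by omega] at h5
      exact hjne h5.symm
  · -- The two walkers are mirror images, and they cannot pass each other.
    have hfar (i : ℕ) (hi : i < r) : e i + 2 ≤ f i ∨ f i + 2 ≤ e i := by
      have h3 := hne i hi
      have h4 := hlab i hi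
      by_contra! hcon
      obtain h | h : e i = f i + 1 ∨ f i = e i + 1 := by omega
      · exact h1 (f i) (by rw [← h, h4])
      · exact h1 (e i) (by rw [← h, h4])
    have hlast := hmir (r - 1) (by omega)
    rcases hfar 0 hr with h0 | h0
    · have : ∀ n < r, e n + 2 ≤ f n := by
        intro n
        induction n with
        | zero => exact fun _ => h0
        | succ n ih =>
          intro hn
          have := ih (by omega)
          have := he n hn
          have := hf n hn
          have := hfar (n + 1) hn
          omega
      have := this (r - 1) (by omega)
      omega
    · have : ∀ n < r, f n + 2 ≤ e n := by
        intro n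
        induction n with
        | zero => exact fun _ => h0
        | succ n ih =>
          intro hn
          have := ih (by omega)
          have := he n hn
          have := hf n hn
          have := hfar (n + 1) hn
          omega
      have := this (r - 1) (by omega)
      omega

end LazyWalk

/-! ### Layers built from two blocks of colors -/

/-- The colors of a layer: a big block (of `⌈k/2⌉` colors, four of them exist) followed by the first
`⌊k/2⌋` colors of another big block (`Sum.inl`) or by a small block (of `⌊k/2⌋` colors, three of
them exist, `Sum.inr`). -/
abbrev BlockPair := Fin 4 × (Fin 4 ⊕ Fin 3)

/-- Two layers have a block in common. -/
def BlockPair.Meets (x y : BlockPair) : Prop :=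
  Sum.inl x.1 = (Sum.inl y.1 : Fin 4 ⊕ Fin 3) ∨ Sum.inl x.1 = y.2 ∨ x.2 = Sum.inl y.1 ∨ x.2 = y.2

instance (x y : BlockPair) : Decidable (x.Meets y) := by
  unfold BlockPair.Meets
  infer_instance

/-- The layer at the positions divisible by four. -/
def markerLayer : BlockPair := (1, Sum.inr 1)

/-- The layer on both sides of the centre of a gap of the given type. -/
def sideLayer : Fin 4 → BlockPair :=
  ![(0, Sum.inl 2), (0, Sum.inl 3), (2, Sum.inr 0), (3, Sum.inr 2)]

/-- The layer at the centre of a gap of the given type. -/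
def centreLayer : Fin 4 → BlockPair :=
  ![(3, Sum.inr 0), (2, Sum.inr 2), (0, Sum.inr 2), (0, Sum.inr 0)]

/-- The layers: copies of `markerLayer` at the multiples of four, and between the `n`-th and the next
one the palindromic gap `side, centre, side` of type `lab n`. -/
def gapLayers (lab : ℕ → Fin 4) (x : ℕ) : BlockPair :=
  if x % 4 = 0 then markerLayer
  else if x % 4 = 2 then centreLayer (lab (x / 4)) else sideLayer (lab (x / 4))

theorem marker_not_meets (σ : Fin 4) :
    ¬ markerLayer.Meets (sideLayer σ) ∧ ¬ markerLayer.Meets (centreLayer σ) ∧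
      ¬ (sideLayer σ).Meets markerLayer ∧ ¬ (centreLayer σ).Meets markerLayer := by
  revert σ
  decide

theorem side_not_meets_centre (σ : Fin 4) :
    ¬ (sideLayer σ).Meets (centreLayer σ) ∧ ¬ (centreLayer σ).Meets (sideLayer σ) := by
  revert σ
  decide

/-- For two different gap types, the side layers or the centre layers have no block in common. -/
theorem eq_of_side_meets_of_centre_meets {σ τ : Fin 4} (hs : (sideLayer σ).Meets (sideLayer τ))
    (hc : (centreLayer σ).Meets (centreLayer τ)) : σ = τ := by
  revert σ τ
  decide

section GapLayers

variable {lab : ℕ → Fin 4}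

theorem gapLayers_of_mod_eq_two {x : ℕ} (hx : x % 4 = 2) :
    gapLayers lab x = centreLayer (lab (x / 4)) := by
  rw [gapLayers, if_neg (by omega), if_pos hx]

theorem gapLayers_of_odd {x : ℕ} (hx : x % 2 = 1) :
    gapLayers lab x = sideLayer (lab (x / 4)) := by
  rw [gapLayers, if_neg (by omega), if_neg (by omega)]

theorem mod_four_eq_zero_iff_of_meets {x y : ℕ}
    (h : (gapLayers lab x).Meets (gapLayers lab y)) : x % 4 = 0 ↔ y % 4 = 0 := by
  unfold gapLayers at h
  by_cases hx : x % 4 = 0 <;> by_cases hy : y % 4 = 0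
  · exact iff_of_true hx hy
  · rw [if_pos hx, if_neg hy] at h
    split_ifs at h
    exacts [absurd h (marker_not_meets _).2.1, absurd h (marker_not_meets _).1]
  · rw [if_neg hx, if_pos hy] at h
    split_ifs at h
    exacts [absurd h (marker_not_meets _).2.2.2, absurd h (marker_not_meets _).2.2.1]
  · exact iff_of_false hx hy

theorem not_meets_of_div_eq {x y : ℕ} (hx : x % 4 ≠ 0) (hy : y % 4 ≠ 0) (hxy : x / 4 = y / 4)
    (hodd : x % 2 ≠ y % 2) : ¬ (gapLayers lab x).Meets (gapLayers lab y) := by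
  rcases Nat.mod_two_eq_zero_or_one x with h | h
  · rw [gapLayers_of_mod_eq_two (by omega), gapLayers_of_odd (by omega), hxy]
    exact (side_not_meets_centre _).2
  · rw [gapLayers_of_odd h, gapLayers_of_mod_eq_two (by omega), hxy]
    exact (side_not_meets_centre _).1

/-! ### Reduction of walks through the layers to lazy walks through the gaps -/

/-- The gap of the last centre (position congruent to 2 modulo 4) visited up to time `i` by a walk
that starts at a centre. -/
def lastCentre (w : ℕ → ℕ) : ℕ → ℕ
  | 0 => w 0 / 4
  | i + 1 => if w (i + 1) % 4 = 2 then w (i + 1) / 4 else lastCentre w i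

theorem lastCentre_of_mod_eq_two {w : ℕ → ℕ} {i : ℕ} (hi : w i % 4 = 2) :
    lastCentre w i = w i / 4 := by
  cases i with
  | zero => rfl
  | succ i => rw [lastCentre, if_pos hi]

theorem lastCentre_succ_of_mod_ne_two {w : ℕ → ℕ} {i : ℕ} (hi : w (i + 1) % 4 ≠ 2) :
    lastCentre w (i + 1) = lastCentre w i := by
  rw [lastCentre, if_neg hi]

theorem lastCentre_bounds {w : ℕ → ℕ} {M : ℕ} (h0 : w 0 % 4 = 2)
    (hw : ∀ i, i + 1 < M → w (i + 1) = w i + 1 ∨ w i = w (i + 1) + 1) :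
    ∀ i < M, 4 * lastCentre w i ≤ w i + 1 ∧ w i ≤ 4 * lastCentre w i + 5 := by
  intro i
  induction i with
  | zero =>
    intro _
    rw [lastCentre]
    omega
  | succ i ih =>
    intro hi
    have := ih (by omega)
    have := hw i hi
    rw [lastCentre]
    split_ifs <;> omega

theorem lastCentre_step {w : ℕ → ℕ} {M : ℕ} (h0 : w 0 % 4 = 2)
    (hw : ∀ i, i + 1 < M → w (i + 1) = w i + 1 ∨ w i = w (i + 1) + 1) (i : ℕ) (hi : i + 1 < M) :
    lastCentre w (i + 1) ≤ lastCentre w i + 1 ∧ lastCentre w i ≤ lastCentre w (i + 1) + 1 := by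
  have := lastCentre_bounds h0 hw i (by omega)
  have := hw i hi
  rw [lastCentre]
  split_ifs <;> omega

/-- A walk through `gapLayers` that matches itself after `l` steps visits some layer at the same
time in both halves. Walks that avoid the markers or the centres are confined to a few layers. For
any other walk, the halves visit centres simultaneously, those centres lie in gaps of the same type,
and the gaps of the last visited centres form a lazy walk. -/
theorem not_walk_gapLayers (h1 : ∀ n, lab n ≠ lab (n + 1)) (h2 : ∀ n, lab n ≠ lab (n + 2))
    (hsq : ∀ d, 0 < d → ∀ i, ∃ j < d, lab (i + j) ≠ lab (i + j + d))
    {l : ℕ} (hl : 0 < l) {w : ℕ → ℕ}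
    (hw : ∀ i, i + 1 < 2 * l → w (i + 1) = w i + 1 ∨ w i = w (i + 1) + 1)
    (hmeet : ∀ i < l, (gapLayers lab (w i)).Meets (gapLayers lab (w (l + i))))
    (hne : ∀ i < l, w i ≠ w (l + i)) : False := by
  have hpar : ∀ i < 2 * l, w i % 2 = (w 0 + i) % 2 := by
    intro i
    induction i with
    | zero => exact fun _ => rfl
    | succ i ih =>
      intro hi
      have := ih (by omega)
      have := hw i hi
      omega
  have hmark (i : ℕ) (hi : i < l) := mod_four_eq_zero_iff_of_meets (hmeet i hi)
  rcases Nat.even_or_odd' l with ⟨l', hl' | hl'⟩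
  swap
  · -- The halves are never at markers simultaneously, so the walk stays inside one gap.
    have hne0 : ∀ j < 2 * l, w j % 4 ≠ 0 := by
      intro j hj hj0
      rcases Nat.lt_or_ge j l with h | h
      · have := (hmark j h).1 hj0
        have := hpar j hj
        have := hpar (l + j) (by omega)
        omega
      · have := hmark (j - l) (by omega)
        rw [show l + (j - l) = j by omega] at this
        have := this.2 hj0
        have := hpar j hj
        have := hpar (j - l) (by omega)
        omega
    have hdiv : ∀ j < 2 * l, w j / 4 = w 0 / 4 := by
      intro j
      induction j with
      | zero => exact fun _ => rfl
      | succ j ih =>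
        intro hj
        have := ih (by omega)
        have := hw j hj
        have := hne0 j (by omega)
        have := hne0 (j + 1) hj
        omega
    have := hpar (l + 0) (by omega)
    exact not_meets_of_div_eq (hne0 0 (by omega)) (hne0 (l + 0) (by omega))
      (hdiv (l + 0) (by omega)).symm (by omega) (hmeet 0 hl)
  have hcentre (i : ℕ) (hi : i < l) : w i % 4 = 2 ↔ w (l + i) % 4 = 2 := by
    have := hmark i hi
    have := hpar i (by omega)
    have := hpar (l + i) (by omega)
    omega
  by_cases hex : ∃ i, i < l ∧ w i % 4 = 2
  swap
  · -- The walk stays around one marker.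
    push Not at hex
    have hne2 : ∀ j < 2 * l, w j % 4 ≠ 2 := by
      intro j hj
      rcases Nat.lt_or_ge j l with h | h
      · exact hex j h
      · have := hcentre (j - l) (by omega)
        rw [show l + (j - l) = j by omega] at this
        exact fun h2 => hex (j - l) (by omega) (this.2 h2)
    have hdiv : ∀ j < 2 * l, (w j + 2) / 4 = (w 0 + 2) / 4 := by
      intro j
      induction j with
      | zero => exact fun _ => rfl
      | succ j ih =>
        intro hj
        have := ih (by omega)
        have := hw j hj
        have := hne2 j (by omega)
        have := hne2 (j + 1) hj
        omega
    -- At time 0 or 1 the first half is at the marker, and hence so is the second half.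
    obtain ⟨i, hi, hi0⟩ : ∃ i < l, w i % 4 = 0 := by
      by_cases h0 : w 0 % 2 = 0
      · exact ⟨0, hl, by have := hne2 0 (by omega); omega⟩
      · exact ⟨1, by omega, by
          have := hne2 1 (by omega); have := hpar 1 (by omega); omega⟩
    have := (hmark i hi).1 hi0
    have := hdiv i (by omega)
    have := hdiv (l + i) (by omega)
    exact hne i hi (by omega)
  obtain ⟨t, ⟨htl, ht2⟩, hmin⟩ : ∃ t, (t < l ∧ w t % 4 = 2) ∧ ∀ i < t, w i % 4 ≠ 2 :=
    ⟨Nat.find hex, Nat.find_spec hex, fun i hi h => Nat.find_min hex hi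
      ⟨hi.trans (Nat.find_spec hex).1, h⟩⟩
  set v : ℕ → ℕ := fun i => w (t + i) with hv
  have hv0 : v 0 % 4 = 2 := ht2
  have hstep := lastCentre_step (M := 2 * l - t) hv0 fun i hi => hw (t + i) (by omega)
  have hvc (i : ℕ) (hi : i < l - t) : v i % 4 = 2 ↔ v (l + i) % 4 = 2 := by
    have := hcentre (t + i) (by omega)
    rwa [show l + (t + i) = t + (l + i) by omega] at this
  have hlab (i : ℕ) (hi : i < l - t) (hi2 : v i % 4 = 2) :
      lab (v i / 4) = lab (v (l + i) / 4) ∧ v i / 4 ≠ v (l + i) / 4 := by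
    have hi2' := (hvc i hi).1 hi2
    have hnei := hne (t + i) (by omega)
    have hmeeti := hmeet (t + i) (by omega)
    rw [show l + (t + i) = t + (l + i) by omega] at hnei hmeeti
    change v i ≠ v (l + i) at hnei
    change (gapLayers lab (v i)).Meets (gapLayers lab (v (l + i))) at hmeeti
    refine ⟨?_, by omega⟩
    rw [gapLayers_of_mod_eq_two hi2, gapLayers_of_mod_eq_two hi2'] at hmeeti
    -- A neighbouring time shows that the side layers of both gaps meet as well.
    obtain ⟨j, hj, hj1, hj2⟩ : ∃ j < l, (w j = v i + 1 ∨ v i = w j + 1) ∧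
        (w (l + j) = v (l + i) + 1 ∨ v (l + i) = w (l + j) + 1) := by
      by_cases hlast : t + i + 1 < l
      · refine ⟨t + i + 1, hlast, hw (t + i) (by omega), ?_⟩
        have := hw (t + (l + i)) (by omega)
        rwa [show t + (l + i) + 1 = l + (t + i + 1) by omega] at this
      · refine ⟨t + i - 1, by omega, ?_, ?_⟩
        · have := hw (t + i - 1) (by omega)
          rw [show t + i - 1 + 1 = t + i by omega] at this
          exact this.symm
        · have := hw (l + (t + i - 1)) (by omega)
          rw [show l + (t + i - 1) + 1 = t + (l + i) by omega] at this
          exact this.symm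
    have hside := hmeet j hj
    rw [gapLayers_of_odd (by omega), gapLayers_of_odd (by omega), show w j / 4 = v i / 4 by omega,
      show w (l + j) / 4 = v (l + i) / 4 by omega] at hside
    exact eq_of_side_meets_of_centre_meets hside hmeeti
  have hinv : ∀ i < l - t, lab (lastCentre v i) = lab (lastCentre v (l + i)) ∧
      lastCentre v i ≠ lastCentre v (l + i) := by
    intro i
    induction i with
    | zero =>
      intro hi
      rw [lastCentre_of_mod_eq_two hv0, lastCentre_of_mod_eq_two ((hvc 0 hi).1 hv0)]
      exact hlab 0 hi hv0
    | succ i ih =>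
      intro hi
      by_cases hi2 : v (i + 1) % 4 = 2
      · rw [lastCentre_of_mod_eq_two hi2, lastCentre_of_mod_eq_two ((hvc _ hi).1 hi2)]
        exact hlab (i + 1) hi hi2
      · rw [lastCentre_succ_of_mod_ne_two hi2, ← add_assoc,
          lastCentre_succ_of_mod_ne_two (i := l + i) fun h => hi2 ((hvc _ hi).2 h)]
        exact ih (by omega)
  -- No centre is visited from the start of the second half until time `l + t`.
  have hconst : ∀ j < t + 1, lastCentre v (l - t - 1 + j) = lastCentre v (l - t - 1) := by
    intro j
    induction j with
    | zero => exact fun _ => rfl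
    | succ j ih =>
      intro hj
      rw [← add_assoc, lastCentre_succ_of_mod_ne_two, ih (by omega)]
      have := hcentre j (by omega)
      have hmj := hmin j (by omega)
      change w (t + (l - t - 1 + j + 1)) % 4 ≠ 2
      rw [show t + (l - t - 1 + j + 1) = l + j by omega]
      tauto
  refine not_lazy_walk h1 h2 hsq (r := l - t) (by omega) (e := lastCentre v)
    (f := fun i => lastCentre v (l + i)) (fun i hi => hstep i (by omega))
    (fun i hi => hstep (l + i) (by omega)) ?_ (fun i hi => (hinv i hi).1)
    (fun i hi => (hinv i hi).2)
  have := hstep (l - 1) (by omega)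
  have hc := hconst t (by omega)
  rw [show l - t - 1 + t = l - 1 by omega] at hc
  rwa [show l - 1 + 1 = l by omega, hc] at this

end GapLayers

/-! ### The upper bound -/

/-- The color of the `i`-th vertex of a layer, where `m` is the size of the big blocks. -/
def blockColor {k m : ℕ} (hk : k ≤ 2 * m) (x : BlockPair) (i : Fin k) :
    Fin 4 × Fin m ⊕ Fin 3 × Fin (k - m) :=
  if h : (i : ℕ) < m then Sum.inl (x.1, ⟨i, h⟩)
  else x.2.map (fun q => (q, ⟨i - m, by omega⟩)) fun q => (q, ⟨i - m, by omega⟩)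

theorem blockColor_block {k m : ℕ} (hk : k ≤ 2 * m) (x : BlockPair) (i : Fin k) :
    (blockColor hk x i).map Prod.fst Prod.fst = if (i : ℕ) < m then Sum.inl x.1 else x.2 := by
  unfold blockColor
  split_ifs
  · rfl
  · rcases x with ⟨p, q | q⟩ <;> rfl

theorem meets_of_blockColor_eq {k m : ℕ} (hk : k ≤ 2 * m) {x y : BlockPair} {i j : Fin k}
    (h : blockColor hk x i = blockColor hk y j) : x.Meets y := by
  have := congrArg (Sum.map Prod.fst Prod.fst) h
  rw [blockColor_block, blockColor_block] at this
  unfold BlockPair.Meets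
  split_ifs at this <;> tauto

theorem blockColor_injective {k m : ℕ} (hk : k ≤ 2 * m) {x : BlockPair}
    (hx : Sum.inl x.1 ≠ x.2) : Function.Injective (blockColor hk x) := by
  intro i j h
  have hb := congrArg (Sum.map Prod.fst Prod.fst) h
  rw [blockColor_block, blockColor_block] at hb
  unfold blockColor at h
  ext
  rcases x with ⟨p, q | q⟩ <;> split_ifs at h hb <;> simp_all <;> omega

theorem gapLayers_inl_fst_ne_snd (lab : ℕ → Fin 4) (x : ℕ) :
    Sum.inl (gapLayers lab x).1 ≠ (gapLayers lab x).2 := by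
  have h : ∀ σ, Sum.inl (sideLayer σ).1 ≠ (sideLayer σ).2 ∧
      Sum.inl (centreLayer σ).1 ≠ (centreLayer σ).2 := by decide
  unfold gapLayers
  split_ifs
  exacts [by decide, (h _).2, (h _).1]

theorem exists_isRainbowNonrepetitive (n k : ℕ) :
    ∃ c : Fin n × Fin k → Fin (3 * k + (k + 1) / 2),
      IsRainbowNonrepetitive (SimpleGraph.pathGraph n) (⊥ : SimpleGraph (Fin k)) c := by
  have hk : k ≤ 2 * ((k + 1) / 2) := by omega
  have hcard : Fintype.card (Fin 4 × Fin ((k + 1) / 2) ⊕ Fin 3 × Fin (k - (k + 1) / 2)) =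
      3 * k + (k + 1) / 2 := by
    simp only [Fintype.card_sum, Fintype.card_prod, Fintype.card_fin]
    omega
  let X := gapLayers digitSumWord
  let c : Fin n × Fin k → Fin (3 * k + (k + 1) / 2) := fun v =>
    Fintype.equivFinOfCardEq hcard (blockColor hk (X v.1) v.2)
  have hinj (v : Fin n) : Function.Injective fun w => c (v, w) :=
    fun _ _ h => blockColor_injective hk (gapLayers_inl_fst_ne_snd _ _) ((Equiv.injective _) h)
  refine ⟨c, (isNonrepetitive_iff _ c).2 fun l f hl hadj hpath hrep => ?_, hinj⟩
  refine not_walk_gapLayers digitSumWord_ne_succ digitSumWord_ne_add_two exists_digitSumWord_ne hl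
    (w := fun i => (f i).1) ?_ ?_ ?_
  · intro i hi
    rcases hadj i hi with h | h
    · rw [SimpleGraph.pathGraph_adj] at h
      omega
    · exact absurd h.2 id
  · intro i hi
    exact meets_of_blockColor_eq hk ((Equiv.injective _) (hrep i hi))
  · intro i hi heq
    -- Equal colors on the same layer belong to the same vertex.
    refine hpath i (l + i) (by omega) (by omega) ?_
    have h1 : (f i).1 = (f (l + i)).1 := Fin.ext heq
    have h2 := hrep i hi
    refine Prod.ext h1 (hinj (f i).1 ?_)
    dsimp only
    rw [Prod.mk.eta, h2, h1]

theorem theorem2 (n k : ℕ) (hn : 24 ≤ n) (hk : 2 ≤ k) :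
    ((3 * k + 1 : ℕ) : ℕ∞) ≤
        rainbowThueNumber (SimpleGraph.pathGraph n) (⊥ : SimpleGraph (Fin k)) ∧
      rainbowThueNumber (SimpleGraph.pathGraph n) (⊥ : SimpleGraph (Fin k)) ≤
        ((3 * k + ⌈(k : ℚ) / 2⌉₊ : ℕ) : ℕ∞) := by
  have hceil : ⌈(k : ℚ) / 2⌉₊ = (k + 1) / 2 := by
    rw [Nat.ceil_eq_iff (by omega)]
    rcases Nat.even_or_odd' k with ⟨j, rfl | rfl⟩
    · rw [show (2 * j + 1) / 2 = j by omega, Nat.cast_sub (by omega)]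
      push_cast
      constructor <;> linarith
    · rw [show (2 * j + 1 + 1) / 2 = j + 1 by omega]
      push_cast [Nat.add_sub_cancel]
      constructor <;> linarith
  constructor
  · refine le_iInf₂ fun m ⟨c, hc⟩ => ?_
    exact_mod_cast hc.three_mul_lt hn hk
  · rw [hceil]
    exact iInf₂_le (f := fun (m : ℕ) _ => (m : ℕ∞)) _ (exists_isRainbowNonrepetitive n k)
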